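/- Let $\mathbb F$ be a finite field and let $d,q\ge 0$ be integers. In the polynomial interpolation problem, coefficients $(a_0,\dots,a_d)\in\mathbb F^{d+1}$ are drawn uniformly at random, and an algorithm that may make $q$ quantum queries to the function $A(x)=\sum_{i=0}^d a_i x^i$ on $\mathbb F$ has to output $(a_0,\dots,a_d)$. An algorithm acts on a finite-dimensional space with orthonormal basis vectors $|x,r,z\rangle$, where $x\in\mathbb F$ and $z$ ranges over a finite workspace of arbitrary size. It starts in a fixed unit vector, applies a fixed unitary (independent of $A$) after each of its $q$ queries, measures in the standard basis, and computes its output from the measured label. A query is either the controlled-add query $|x,g,z\rangle\mapsto|x,g+A(x),z\rangle$, $g\in\mathbb F$, or the phase query $|x,\xi,z\rangle\mapsto\xi(A(x))\,|x,\xi,z\rangle$, $\xi$ a character of $(\mathbb F,+)$. The success probability is the average over the random coefficients of the probability that the output is correct. **Theorem.** The success probability of $q$-query algorithms attains a maximum $P$, which is the same in both query models, and 1. if $q\le \frac d2$, then $P\le \frac1{|\mathbb F|}$; 2. if $q=\frac d2+\frac12$, then $P\ge\frac1{q!}\left(1-\binom{q+1}2\frac1{|\mathbb F|}\right)$, and,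 provided $q\le|\mathbb F|$ (in particular whenever $d<|\mathbb F|$), also $P\le\frac1{q!}$; 3. if $q\ge\frac d2+1$, then $P\ge 1-\dfrac{(\lfloor d/2\rfloor+1)!+d+1}{|\mathbb F|}$. -/

import Mathlib

noncomputable section

namespace QuantumQuery

/-- Pure states of a query register with basis `X`, a response register with basis `R` and a
workspace of dimension `w`; the basis vectors are `|x, r, z⟩`. -/
abbrev StateSpace (X R : Type*) [Fintype X] [Fintype R] (w : ℕ) : Type _ :=
  EuclideanSpace ℂ (X × R × Fin w)

/-- The controlled-add query `|x, g, z⟩ ↦ |x, g + A x, z⟩`: the amplitude of `|x, g, z⟩` after the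
query is the amplitude of `|x, g - A x, z⟩` before it. -/
def addQuery {X G : Type*} [Fintype X] [Fintype G] [AddCommGroup G] (A : X → G) (w : ℕ)
    (ψ : StateSpace X G w) : StateSpace X G w :=
  WithLp.toLp 2 fun b => ψ (b.1, b.2.1 - A b.1, b.2.2)

/-- The phase query `|x, ξ, z⟩ ↦ ξ (A x) |x, ξ, z⟩`, with `ξ` a character of `G`. -/
def phaseQuery {X G : Type*} [Fintype X] [AddCommGroup G] [Fintype (AddChar G ℂ)] (A : X → G)
    (w : ℕ) (ψ : StateSpace X (AddChar G ℂ) w) : StateSpace X (AddChar G ℂ) w :=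
  WithLp.toLp 2 fun b => b.2.1 (A b.1) * ψ b

/-- A quantum query algorithm: an arbitrary finite-dimensional workspace, a unit initial state, a
unitary `step k` applied to all registers after query number `k` (counting from `0`), and a
classical function that turns the outcome of the final measurement in the standard basis into an
output. In a run with `q` queries only `step 0, …, step (q - 1)` are used. -/
structure Algorithm (X R Out : Type*) [Fintype X] [Fintype R] where
  /-- dimension of the workspace -/
  dim : ℕ
  /-- initial state -/
  init : StateSpace X R dim
  norm_init : ‖init‖ = 1
  /-- unitaries between the queries and after the last one -/
  step : ℕ → (StateSpace X R dim ≃ₗᵢ[ℂ] StateSpace X R dim)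
  /-- classical post-processing of the measured basis label -/
  output : X × R × Fin dim → Out

namespace Algorithm

variable {X R Out : Type*} [Fintype X] [Fintype R]

/-- The state after `k` queries, where `query` is the action of one query. -/
def state (𝒬 : Algorithm X R Out) (query : StateSpace X R 𝒬.dim → StateSpace X R 𝒬.dim) :
    ℕ → StateSpace X R 𝒬.dim
  | 0 => 𝒬.init
  | k + 1 => 𝒬.step k (query (𝒬.state query k))

open Classical in
/-- The probability that the algorithm outputs `o` after `q` queries. -/
def outputProb (𝒬 : Algorithm X R Out) (query : StateSpace X R 𝒬.dim → StateSpace X R 𝒬.dim)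
    (q : ℕ) (o : Out) : ℝ :=
  ∑ b : X × R × Fin 𝒬.dim, if 𝒬.output b = o then ‖𝒬.state query q b‖ ^ 2 else 0

end Algorithm

/-- The function computed by the polynomial `∑ aᵢ xⁱ` of degree at most `d`. -/
def polyFun {F : Type*} [Field F] {d : ℕ} (a : Fin (d + 1) → F) (x : F) : F :=
  ∑ i, a i * x ^ (i : ℕ)

/-- All success probabilities that algorithms with `q` queries achieve in polynomial
interpolation: the `d + 1` coefficients are uniformly random, and the algorithm succeeds when it
outputs all of them. The parameter `query A w` is the action of a query to the function `A` on
states with a workspace of dimension `w`. -/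
def interpolationProbs {F R : Type*} [Field F] [Fintype F] [Fintype R]
    (query : (F → F) → (w : ℕ) → StateSpace F R w → StateSpace F R w) (d q : ℕ) : Set ℝ :=
  {p | ∃ 𝒬 : Algorithm F R (Fin (d + 1) → F),
    p = (∑ a : Fin (d + 1) → F, 𝒬.outputProb (query (polyFun a) 𝒬.dim) q a) /
      (Fintype.card F : ℝ) ^ (d + 1)}

end QuantumQuery

end

/-! In both models a query is diagonal in an orthonormal basis labelled by `(x, c, z)`, with
eigenvalue `e (c * A x)` for a fixed primitive character `e` (`isDiagonal_phaseQuery`,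
`isDiagonal_addQuery`). Since `A x = powers d x ⬝ᵥ a`, a query adds `c • powers d x` to the
frequency of the state as a function of `a`. After `q` queries the state is thus a sum of `e (y ⬝ᵥ
a) • v y` over `y ∈ powerSums F d q`, with `v` independent of `a`.

All final states lie in a space of dimension at most `#(powerSums F d q)`, which bounds the sum of
the success probabilities. Conversely, a uniform superposition over `powerSums F d q` can acquire
exactly these phases, and an inverse Fourier transform then attains the bound. Hence `P =
#(powerSums F d q) / #F ^ (d + 1)` in both models (`IsDiagonal.isGreatest`).

What remains is to count the moment vectors of functions with at most `q` non-zero values. For `2 *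
q ≤ d` counting parameters is enough. For `2 * q = d + 1` functions of weight `q` are determined by
their moments (Vandermonde), and choosing supports yields the factor `1 / q!`. For larger `q` a
second moment argument (`card_weightFuns_sq_le`) shows that almost every vector is hit; odd `d`
reduces to `d - 1` by using the node `0`. -/

noncomputable section

open Finset Matrix

namespace QuantumQuery

/-! ### Diagonal queries and the dimension bound -/

section Diagonal

variable {F : Type*} [Field F] {d : ℕ}

/-- The vector `(1, x, …, x ^ d)`. -/
def powers (d : ℕ) (x : F) : Fin (d + 1) → F := fun j => x ^ (j : ℕ)

open Classical in
/-- The linear combinations of `q` vectors of the form `(1, x, …, x ^ d)`. -/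
def powerSums (F : Type*) [Field F] [Fintype F] (d q : ℕ) : Finset (Fin (d + 1) → F) :=
  univ.image fun p : Fin q → F × F => ∑ i, (p i).2 • powers d (p i).1

theorem polyFun_eq_dotProduct (a : Fin (d + 1) → F) (x : F) : polyFun a x = powers d x ⬝ᵥ a := by
  simp [polyFun, powers, dotProduct, mul_comm]

variable [Fintype F]

theorem mem_powerSums {q : ℕ} {y : Fin (d + 1) → F} :
    y ∈ powerSums F d q ↔ ∃ p : Fin q → F × F, ∑ i, (p i).2 • powers d (p i).1 = y := by
  simp [powerSums]

theorem add_mem_powerSums_succ {q : ℕ} {y : Fin (d + 1) → F} (hy : y ∈ powerSums F d q)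
    (c x : F) : y + c • powers d x ∈ powerSums F d (q + 1) := by
  obtain ⟨p, rfl⟩ := mem_powerSums.1 hy
  exact mem_powerSums.2 ⟨Fin.snoc p (x, c), by simp [Fin.sum_univ_castSucc]⟩

variable {R : Type*} [Fintype R]

/-- A kind of query is diagonal with respect to the character `e` if some orthonormal basis of
vectors labelled by `x`, `c` and `z` consists of eigenvectors of all queries, with eigenvalues
`e (c * A x)`. -/
def IsDiagonal (e : AddChar F ℂ)
    (query : (F → F) → (w : ℕ) → StateSpace F R w → StateSpace F R w) : Prop :=
  ∀ w, ∃ b : OrthonormalBasis (F × F × Fin w) ℂ (StateSpace F R w),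
    ∀ A ψ i, b.repr (query A w ψ) i = e (i.2.1 * A i.1) * b.repr ψ i

variable {e : AddChar F ℂ} {query : (F → F) → (w : ℕ) → StateSpace F R w → StateSpace F R w}

theorem IsDiagonal.norm_query (h : IsDiagonal e query) (A : F → F) (w : ℕ)
    (ψ : StateSpace F R w) : ‖query A w ψ‖ = ‖ψ‖ := by
  obtain ⟨b, hb⟩ := h w
  rw [← b.repr.norm_map, ← b.repr.norm_map ψ, EuclideanSpace.norm_eq, EuclideanSpace.norm_eq]
  simp [hb]

theorem IsDiagonal.norm_state (h : IsDiagonal e query) {Out : Type*} (𝒬 : Algorithm F R Out)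
    (A : F → F) (k : ℕ) : ‖𝒬.state (query A 𝒬.dim) k‖ = 1 := by
  induction k with
  | zero => exact 𝒬.norm_init
  | succ k ih => rw [Algorithm.state, LinearIsometryEquiv.norm_map, h.norm_query, ih]

/-- In the eigenbasis, the coordinate at `(x, c, z)` gains the factor `e ((c • powers d x) ⬝ᵥ a)`,
so its frequency `y` moves to `y + c • powers d x`. The new coefficient `v' y` therefore reads each
coordinate from `v` at the frequency shifted back. -/
theorem IsDiagonal.exists_query_eq_sum (h : IsDiagonal e query) (w k : ℕ)
    (v : (Fin (d + 1) → F) → StateSpace F R w) (hv : ∀ y ∉ powerSums F d k, v y = 0) :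
    ∃ v' : (Fin (d + 1) → F) → StateSpace F R w, (∀ y ∉ powerSums F d (k + 1), v' y = 0) ∧
      ∀ a, query (polyFun a) w (∑ y, e (y ⬝ᵥ a) • v y) = ∑ y, e (y ⬝ᵥ a) • v' y := by
  obtain ⟨b, hb⟩ := h w
  refine ⟨fun y => b.repr.symm (WithLp.toLp 2 fun i => b.repr (v (y - i.2.1 • powers d i.1)) i),
    fun y hy => ?_, fun a => ?_⟩
  · have : (fun i : F × F × Fin w => b.repr (v (y - i.2.1 • powers d i.1)) i) = 0 := by
      ext i
      rw [hv, map_zero]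
      · rfl
      · intro hm
        have := add_mem_powerSums_succ hm i.2.1 i.1
        rw [sub_add_cancel] at this
        exact hy this
    simp only [this, WithLp.toLp_zero, map_zero]
  · apply b.repr.injective
    ext i
    rw [hb]
    simp only [map_sum, map_smul, LinearIsometryEquiv.apply_symm_apply, WithLp.ofLp_sum,
      WithLp.ofLp_smul, Finset.sum_apply, Pi.smul_apply, smul_eq_mul, mul_sum]
    refine Eq.trans ?_ (Equiv.sum_comp (Equiv.addRight (i.2.1 • powers d i.1)) _)
    refine sum_congr rfl fun y _ => ?_
    simp only [Equiv.coe_addRight, add_sub_cancel_right, add_dotProduct, smul_dotProduct,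
      AddChar.map_add_eq_mul, polyFun_eq_dotProduct, smul_eq_mul]
    ring

theorem IsDiagonal.exists_state_eq_sum (h : IsDiagonal e query) {Out : Type*}
    (𝒬 : Algorithm F R Out) (d k : ℕ) :
    ∃ v : (Fin (d + 1) → F) → StateSpace F R 𝒬.dim, (∀ y ∉ powerSums F d k, v y = 0) ∧
      ∀ a, 𝒬.state (query (polyFun a) 𝒬.dim) k = ∑ y, e (y ⬝ᵥ a) • v y := by
  classical
  induction k with
  | zero =>
    refine ⟨fun y => if y = 0 then 𝒬.init else 0, fun y hy => if_neg fun h0 => hy ?_, fun a => ?_⟩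
    · exact mem_powerSums.2 ⟨Fin.elim0, by simp [h0]⟩
    · simp [Algorithm.state]
  | succ k ih =>
    obtain ⟨v, hv, hs⟩ := ih
    obtain ⟨v', hv', hq⟩ := h.exists_query_eq_sum 𝒬.dim k v hv
    refine ⟨fun y => 𝒬.step k (v' y), fun y hy => by simp [hv' y hy], fun a => ?_⟩
    rw [Algorithm.state, hs, hq]
    simp

open Classical in
/-- Unit vectors in the span of `s` are not distinguished better than by guessing one of
`#s` values. -/
theorem sum_sum_norm_sq_le_card {ι Out : Type*} [Fintype ι] [Fintype Out] (out : ι → Out)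
    (ψ : Out → EuclideanSpace ℂ ι) (hψ : ∀ o, ‖ψ o‖ = 1) (s : Finset (EuclideanSpace ℂ ι))
    (hs : ∀ o, ψ o ∈ Submodule.span ℂ (s : Set (EuclideanSpace ℂ ι))) :
    ∑ o, ∑ i, (if out i = o then ‖ψ o i‖ ^ 2 else 0) ≤ #s := by
  set S := Submodule.span ℂ (s : Set (EuclideanSpace ℂ ι))
  let b := stdOrthonormalBasis ℂ S
  -- Cauchy–Schwarz bounds each outcome probability by a diagonal entry of the projection onto the
  -- span. Each outcome `i` counts for the single value `out i`, so the total is at most the trace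
  -- of the projection, its rank.
  have key : ∀ o i, ‖ψ o i‖ ^ 2 ≤ ∑ k, ‖(b k : EuclideanSpace ℂ ι) i‖ ^ 2 := by
    intro o i
    let φ : S := ⟨ψ o, hs o⟩
    have h1 : ψ o i = ∑ k, b.repr φ k * (b k : EuclideanSpace ℂ ι) i := by
      have := congrArg (fun v : S => (v : EuclideanSpace ℂ ι) i) (b.sum_repr φ)
      simpa [φ] using this.symm
    have h2 : ∑ k, ‖b.repr φ k‖ ^ 2 = 1 := by
      rw [← EuclideanSpace.norm_sq_eq, LinearIsometryEquiv.norm_map]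
      change ‖ψ o‖ ^ 2 = 1
      rw [hψ, one_pow]
    calc ‖ψ o i‖ ^ 2 ≤ (∑ k, ‖b.repr φ k‖ * ‖(b k : EuclideanSpace ℂ ι) i‖) ^ 2 := by
          gcongr
          rw [h1]
          exact (norm_sum_le _ _).trans (by simp)
      _ ≤ (∑ k, ‖b.repr φ k‖ ^ 2) * ∑ k, ‖(b k : EuclideanSpace ℂ ι) i‖ ^ 2 :=
          sum_mul_sq_le_sq_mul_sq _ _ _
      _ = _ := by rw [h2, one_mul]
  calc ∑ o, ∑ i, (if out i = o then ‖ψ o i‖ ^ 2 else 0)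
      = ∑ i, ‖ψ (out i) i‖ ^ 2 := by rw [sum_comm]; simp
    _ ≤ ∑ i, ∑ k, ‖(b k : EuclideanSpace ℂ ι) i‖ ^ 2 := sum_le_sum fun i _ => key _ i
    _ = ∑ k, ‖(b k : EuclideanSpace ℂ ι)‖ ^ 2 := by
        rw [sum_comm]; simp [EuclideanSpace.norm_sq_eq]
    _ = ∑ k, (1 : ℝ) := by
        refine sum_congr rfl fun k _ => ?_
        have : ‖(b k : EuclideanSpace ℂ ι)‖ = 1 := b.orthonormal.1 k
        rw [this, one_pow]
    _ ≤ #s := by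
        simpa [S, Set.finrank] using finrank_span_finset_le_card (R := ℂ) s

theorem IsDiagonal.sum_outputProb_le (h : IsDiagonal e query) (d q : ℕ)
    (𝒬 : Algorithm F R (Fin (d + 1) → F)) :
    ∑ a, 𝒬.outputProb (query (polyFun a) 𝒬.dim) q a ≤ #(powerSums F d q) := by
  classical
  obtain ⟨v, hv, hs⟩ := h.exists_state_eq_sum 𝒬 d q
  refine le_trans (sum_sum_norm_sq_le_card 𝒬.output
    (fun a => 𝒬.state (query (polyFun a) 𝒬.dim) q) (fun a => h.norm_state 𝒬 _ _)
    ((powerSums F d q).image v) fun a => ?_) (by exact_mod_cast card_image_le)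
  simp only [hs]
  refine Submodule.sum_mem _ fun y _ => Submodule.smul_mem _ _ ?_
  by_cases hy : y ∈ powerSums F d q
  · exact Submodule.subset_span (by simpa using ⟨y, hy, rfl⟩)
  · rw [hv y hy]
    exact Submodule.zero_mem _

/-- Both families extend to orthonormal bases indexed by `J`; placing them through the same
injection `f` makes the change of basis send `u i` to `v i`. -/
theorem exists_linearIsometryEquiv_of_orthonormal {ι E : Type*} [NormedAddCommGroup E]
    [InnerProductSpace ℂ E] [FiniteDimensional ℂ E] {J : Type*} [Fintype J]
    (hJ : Module.finrank ℂ E = Fintype.card J) (f : ι → J) (hf : Function.Injective f)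
    {u v : ι → E} (hu : Orthonormal ℂ u) (hv : Orthonormal ℂ v) :
    ∃ U : E ≃ₗᵢ[ℂ] E, ∀ i, U (u i) = v i := by
  have ext : ∀ {u : ι → E}, Orthonormal ℂ u → ∃ b : OrthonormalBasis J ℂ E, ∀ i, b (f i) = u i := by
    intro u hu
    have ho : Orthonormal ℂ ((Set.range f).domRestrict (Function.extend f u 0)) := by
      have := hu.comp (Equiv.ofInjective f hf).symm (Equiv.injective _)
      convert this using 1
      ext ⟨j, i, rfl⟩
      simp [hf.extend_apply, Equiv.ofInjective_symm_apply]
    obtain ⟨b, hb⟩ := ho.exists_orthonormalBasis_extension_of_card_eq hJ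
    exact ⟨b, fun i => by rw [hb _ ⟨i, rfl⟩, hf.extend_apply]⟩
  obtain ⟨b, hb⟩ := ext hu
  obtain ⟨b', hb'⟩ := ext hv
  exact ⟨b.equiv b' (Equiv.refl _), fun i => by rw [← hb, ← hb']; simp⟩

end Diagonal

/-! ### The optimal algorithm and the two query models -/

section Models

theorem map_sum_eq_prod {F : Type*} [AddCommMonoid F] (e : AddChar F ℂ) {ι : Type*} (s : Finset ι)
    (f : ι → F) : e (∑ i ∈ s, f i) = ∏ i ∈ s, e (f i) :=
  map_prod e.toMonoidHom (fun i => Multiplicative.ofAdd (f i)) s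

variable {F : Type*} [Field F] [Fintype F] {R : Type*} [Fintype R] {d : ℕ} {e : AddChar F ℂ}
  {query : (F → F) → (w : ℕ) → StateSpace F R w → StateSpace F R w}

open Classical in
-- The sum factors over the coordinates of `a`, and each factor is a complete character sum.
theorem sum_dotProduct_eq (he : e.IsPrimitive) (y y' : Fin (d + 1) → F) :
    ∑ a, (starRingEnd ℂ) (e (-(y ⬝ᵥ a))) * e (-(y' ⬝ᵥ a)) =
      if y = y' then (Fintype.card F : ℂ) ^ (d + 1) else 0 := by
  have h1 : ∀ a : Fin (d + 1) → F, (starRingEnd ℂ) (e (-(y ⬝ᵥ a))) * e (-(y' ⬝ᵥ a)) =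
      ∏ j, e (a j * (y j - y' j)) := by
    intro a
    rw [← AddChar.map_neg_eq_conj, ← AddChar.map_add_eq_mul, ← map_sum_eq_prod]
    congr 1
    simp only [dotProduct, neg_neg, ← sub_eq_add_neg, ← sum_sub_distrib]
    exact sum_congr rfl fun j _ => by ring
  simp only [h1]
  rw [← Fintype.piFinset_univ, ← prod_univ_sum (fun _ => univ) fun j x => e (x * (y j - y' j))]
  simp only [AddChar.sum_mulShift _ he, sub_eq_zero]
  split_ifs with h
  · simp [h]
  · obtain ⟨j, hj⟩ := Function.ne_iff.1 h
    exact prod_eq_zero (mem_univ j) (by simp [hj])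

/-- The Fourier vector with frequency `y`, in the workspace register. -/
def fourierVec {w : ℕ} (e : AddChar F ℂ) (j : (Fin (d + 1) → F) ≃ Fin w) (r : F × R)
    (y : Fin (d + 1) → F) : StateSpace F R w :=
  ∑ a, (e (-(y ⬝ᵥ a)) / (√((Fintype.card F : ℝ) ^ (d + 1)) : ℝ)) •
    EuclideanSpace.basisFun (F × R × Fin w) ℂ (r.1, r.2, j a)

theorem orthonormal_fourierVec {w : ℕ} (he : e.IsPrimitive) (j : (Fin (d + 1) → F) ≃ Fin w)
    (r : F × R) : Orthonormal ℂ (fourierVec e j r) := by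
  classical
  have hb : Orthonormal ℂ fun a : Fin (d + 1) → F =>
      EuclideanSpace.basisFun (F × R × Fin w) ℂ (r.1, r.2, j a) :=
    (EuclideanSpace.basisFun (F × R × Fin w) ℂ).orthonormal.comp _ fun a a' h => by
      simpa using h
  have hn : (0 : ℝ) < (Fintype.card F : ℝ) ^ (d + 1) := by
    have := Fintype.card_pos (α := F); positivity
  rw [orthonormal_iff_ite]
  intro y y'
  rw [fourierVec, fourierVec, hb.inner_sum]
  have h2 : ((√((Fintype.card F : ℝ) ^ (d + 1)) : ℝ) : ℂ) * (√((Fintype.card F : ℝ) ^ (d + 1)) : ℝ)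
      = (Fintype.card F : ℂ) ^ (d + 1) := by
    rw [← Complex.ofReal_mul, Real.mul_self_sqrt hn.le]
    push_cast; rfl
  have h3 : (Fintype.card F : ℂ) ^ (d + 1) ≠ 0 := by exact_mod_cast hn.ne'
  simp only [map_div₀, Complex.conj_ofReal, div_mul_div_comm, h2]
  rw [← sum_div, sum_dotProduct_eq he]
  split_ifs <;> simp [h3]

theorem fourierVec_apply {w : ℕ} (j : (Fin (d + 1) → F) ≃ Fin w) (r : F × R)
    (y a : Fin (d + 1) → F) : fourierVec e j r y (r.1, r.2, j a) =
      e (-(y ⬝ᵥ a)) / (√((Fintype.card F : ℝ) ^ (d + 1)) : ℝ) := by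
  classical
  simp [fourierVec, Pi.single_apply]

/-- For each `y` in `S` fix a decomposition into `q` terms and let query `k` contribute the phase of
the `k`-th term. The workspace remembers `y`, so the branches stay orthogonal until they are rotated
to Fourier vectors. -/
theorem IsDiagonal.exists_algorithm [Nonempty R] (h : IsDiagonal e query) (he : e.IsPrimitive)
    (d q : ℕ) : ∃ 𝒬 : Algorithm F R (Fin (d + 1) → F),
      (#(powerSums F d q) : ℝ) ≤ ∑ a, 𝒬.outputProb (query (polyFun a) 𝒬.dim) q a := by
  classical
  set S := powerSums F d q
  let j := Fintype.equivFin (Fin (d + 1) → F)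
  set w := Fintype.card (Fin (d + 1) → F)
  obtain ⟨b, hb⟩ := h w
  let r : F × R := (0, Classical.arbitrary R)
  have hp : ∀ y : Fin (d + 1) → F, ∃ p : Fin q → F × F,
      y ∈ S → ∑ i, (p i).2 • powers d (p i).1 = y := by
    intro y
    by_cases hy : y ∈ S
    · obtain ⟨p, hp⟩ := mem_powerSums.1 hy
      exact ⟨p, fun _ => hp⟩
    · exact ⟨0, fun h => absurd h hy⟩
  choose p hp using hp
  let t : (Fin (d + 1) → F) → ℕ → F × F := fun y k => if hk : k < q then p y ⟨k, hk⟩ else 0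
  have ht : ∀ y ∈ S, ∑ k ∈ range q, (t y k).2 • powers d (t y k).1 = y := by
    intro y hy
    rw [sum_range]
    simpa [t] using hp y hy
  -- Branch `y` just before query `k` is the eigenvector for its `k`-th term; from time `q` on it is
  -- the Fourier vector of `y`.
  let u : ℕ → (Fin (d + 1) → F) → StateSpace F R w := fun k y =>
    if k < q then b ((t y k).1, (t y k).2, j y) else fourierVec e j r y
  have hu : ∀ k, Orthonormal ℂ (u k) := by
    intro k
    by_cases hk : k < q
    · simp only [u, hk, if_true]
      exact b.orthonormal.comp _ fun y y' h => by simpa using (Prod.ext_iff.1 (Prod.ext_iff.1 h).2).2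
    · simp only [u, hk, if_false]
      exact orthonormal_fourierVec he j r
  have hU := fun k => exists_linearIsometryEquiv_of_orthonormal
    (Module.finrank_eq_card_basis b.toBasis) (fun y : Fin (d + 1) → F => ((0 : F), (0 : F), j y))
    (fun y y' h => by simpa using h) (hu k) (hu (k + 1))
  choose U hU using hU
  have hS : 0 < (#S : ℝ) := by
    have : S.Nonempty := ⟨_, mem_powerSums.2 ⟨0, rfl⟩⟩
    exact_mod_cast this.card_pos
  let s : ℂ := ((√(#S : ℝ) : ℝ) : ℂ)⁻¹
  have hs : ‖s‖ ^ 2 * #S = 1 := by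
    simp only [s, norm_inv, Complex.norm_real, Real.norm_eq_abs, inv_pow, sq_abs]
    rw [Real.sq_sqrt hS.le, inv_mul_cancel₀ hS.ne']
  let 𝒬 : Algorithm F R (Fin (d + 1) → F) :=
    { dim := w
      init := ∑ y ∈ S, s • u 0 y
      norm_init := by
        have h1 : ‖∑ y ∈ S, s • u 0 y‖ ^ 2 = 1 := by
          rw [@norm_sq_eq_re_inner ℂ, (hu 0).inner_sum]
          simp only [← Complex.normSq_eq_conj_mul_self, Complex.normSq_eq_norm_sq, sum_const,
            nsmul_eq_mul, ← hs]
          rw [mul_comm]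
          norm_cast
        exact (sq_eq_sq₀ (norm_nonneg _) zero_le_one).1 (by rw [h1, one_pow])
      step := U
      output := fun i => j.symm i.2.2 }
  -- `IsDiagonal` does not include linearity of `query`; it is read off from the coordinates.
  have hlin : ∀ A (c : (Fin (d + 1) → F) → ℂ) (i : (Fin (d + 1) → F) → F × F × Fin w),
      query A w (∑ y ∈ S, c y • b (i y)) =
        ∑ y ∈ S, c y • e ((i y).2.1 * A (i y).1) • b (i y) := by
    intro A c i
    apply b.repr.injective
    ext i'
    simp only [hb, map_sum, map_smul, WithLp.ofLp_sum, WithLp.ofLp_smul, Finset.sum_apply,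
      Pi.smul_apply, smul_eq_mul, mul_sum, b.repr_self]
    refine sum_congr rfl fun y _ => ?_
    by_cases hi : i' = i y
    · subst hi; simp [mul_comm]
    · simp [hi]
  have hstate : ∀ a k, k ≤ q → 𝒬.state (query (polyFun a) w) k =
      ∑ y ∈ S, (s * e ((∑ l ∈ range k, (t y l).2 • powers d (t y l).1) ⬝ᵥ a)) • u k y := by
    intro a k
    induction k with
    | zero => intro _; simp [Algorithm.state, 𝒬]
    | succ k ih =>
      intro hk
      rw [Algorithm.state, ih (by omega)]
      have huk : ∀ y, u k y = b ((t y k).1, (t y k).2, j y) := fun y => if_pos (by omega)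
      simp only [huk]
      rw [hlin]
      simp only [← huk, map_sum, map_smul]
      refine sum_congr rfl fun y _ => ?_
      rw [show 𝒬.step k (u k y) = u (k + 1) y from hU k y, smul_smul, sum_range_succ,
        add_dotProduct, AddChar.map_add_eq_mul, smul_dotProduct, polyFun_eq_dotProduct, smul_eq_mul,
        mul_assoc]
  -- The phase `e (y ⬝ᵥ a)` cancels the Fourier coefficient `e (-(y ⬝ᵥ a))`, so all `#S` branches
  -- interfere constructively at the correct answer.
  have hamp : ∀ a, 𝒬.state (query (polyFun a) w) q (r.1, r.2, j a) =
      #S * s / (√((Fintype.card F : ℝ) ^ (d + 1)) : ℝ) := by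
    intro a
    rw [hstate a q le_rfl]
    have huq : ∀ y, u q y = fourierVec e j r y := fun y => if_neg (lt_irrefl q)
    simp only [WithLp.ofLp_sum, WithLp.ofLp_smul, Finset.sum_apply, Pi.smul_apply, smul_eq_mul,
      huq]
    rw [sum_congr rfl (g := fun _ => s / (√((Fintype.card F : ℝ) ^ (d + 1)) : ℝ)), sum_const,
      nsmul_eq_mul, mul_div_assoc]
    intro y hy
    rw [ht y hy, fourierVec_apply, mul_div_assoc', mul_assoc, ← AddChar.map_add_eq_mul]
    simp
  refine ⟨𝒬, ?_⟩
  have hn : (0 : ℝ) < (Fintype.card F : ℝ) ^ (d + 1) := by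
    have := Fintype.card_pos (α := F); positivity
  have hprob : ∀ a, (#S : ℝ) / (Fintype.card F : ℝ) ^ (d + 1) ≤
      𝒬.outputProb (query (polyFun a) 𝒬.dim) q a := by
    intro a
    have h1 : ‖𝒬.state (query (polyFun a) w) q (r.1, r.2, j a)‖ ^ 2 =
        (#S : ℝ) / (Fintype.card F : ℝ) ^ (d + 1) := by
      rw [hamp, norm_div, norm_mul, Complex.norm_real, Real.norm_eq_abs, div_pow, sq_abs,
        Real.sq_sqrt hn.le, mul_pow, Complex.norm_natCast]
      congr 1
      calc (#S : ℝ) ^ 2 * ‖s‖ ^ 2 = (#S : ℝ) * (‖s‖ ^ 2 * #S) := by ring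
        _ = (#S : ℝ) := by rw [hs, mul_one]
    rw [← h1, Algorithm.outputProb]
    refine le_trans ?_ (single_le_sum (fun i _ => by split_ifs <;> positivity)
      (mem_univ ((r.1, r.2, j a) : F × R × Fin w)))
    simp [𝒬]
  calc (#S : ℝ) = ∑ a : Fin (d + 1) → F, (#S : ℝ) / (Fintype.card F : ℝ) ^ (d + 1) := by
        simp [mul_div_cancel₀, hn.ne']
    _ ≤ _ := sum_le_sum fun a _ => hprob a

theorem IsDiagonal.isGreatest [Nonempty R] (h : IsDiagonal e query) (he : e.IsPrimitive)
    (d q : ℕ) : IsGreatest (interpolationProbs query d q)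
      (#(powerSums F d q) / (Fintype.card F : ℝ) ^ (d + 1)) := by
  constructor
  · obtain ⟨𝒬, h𝒬⟩ := h.exists_algorithm he d q
    exact ⟨𝒬, by rw [(h.sum_outputProb_le d q 𝒬).antisymm h𝒬]⟩
  · rintro _ ⟨𝒬, rfl⟩
    gcongr
    exact h.sum_outputProb_le d q 𝒬

/-- By primitivity every character is `e.mulShift c` for a unique `c`, so the standard basis only
needs relabelling. -/
theorem isDiagonal_phaseQuery (he : e.IsPrimitive) [Fintype (AddChar F ℂ)] :
    IsDiagonal e (phaseQuery (X := F) (G := F)) := by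
  intro w
  have hbij : Function.Bijective e.mulShift := by
    rw [Fintype.bijective_iff_injective_and_card]
    refine ⟨AddChar.to_mulShift_inj_of_isPrimitive he, ?_⟩
    convert (AddChar.card_eq (α := F)).symm
  let σ : F ≃ AddChar F ℂ := Equiv.ofBijective _ hbij
  refine ⟨(EuclideanSpace.basisFun (F × AddChar F ℂ × Fin w) ℂ).reindex
    ((Equiv.refl F).prodCongr (σ.prodCongr (Equiv.refl (Fin w)))).symm, fun A ψ i => ?_⟩
  simp [OrthonormalBasis.reindex, phaseQuery, σ, AddChar.mulShift_apply]

theorem isDiagonal_addQuery (he : e.IsPrimitive) :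
    IsDiagonal e (addQuery (X := F) (G := F)) := by
  classical
  intro w
  have hn : (0 : ℝ) < (Fintype.card F : ℝ) := by exact_mod_cast Fintype.card_pos (α := F)
  have hsq : ((√(Fintype.card F : ℝ) : ℝ) : ℂ) * (√(Fintype.card F : ℝ) : ℝ) =
      (Fintype.card F : ℂ) := by
    rw [← Complex.ofReal_mul, Real.mul_self_sqrt hn.le]
    push_cast; rfl
  -- Fourier basis of the response register: translating `g` by `A x` multiplies the vector of
  -- frequency `c` by `e (c * A x)`.
  let v : F × F × Fin w → StateSpace F F w := fun i => WithLp.toLp 2 fun l =>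
    if l.1 = i.1 ∧ l.2.2 = i.2.2 then e (-(i.2.1 * l.2.1)) / (√(Fintype.card F : ℝ) : ℝ) else 0
  have inner_v : ∀ i ψ, inner ℂ (v i) ψ =
      ∑ g, e (i.2.1 * g) / (√(Fintype.card F : ℝ) : ℝ) * ψ (i.1, g, i.2.2) := by
    intro i ψ
    simp only [v, PiLp.inner_apply, RCLike.inner_apply, Fintype.sum_prod_type, ite_and, apply_ite,
      map_zero, mul_zero, map_div₀, Complex.conj_ofReal, ← AddChar.map_neg_eq_conj, neg_neg]
    rw [sum_eq_single i.1 (fun x _ hx => by simp [hx]) (by simp)]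
    refine sum_congr rfl fun g _ => ?_
    rw [sum_eq_single i.2.2 (fun x _ hx => by simp [hx]) (by simp)]
    simp [mul_comm]
  have hv : Orthonormal ℂ v := by
    rw [orthonormal_iff_ite]
    intro i i'
    rw [inner_v]
    by_cases h1 : i.1 = i'.1 ∧ i.2.2 = i'.2.2
    · have h2 : ∀ g : F, e (i.2.1 * g) / (√(Fintype.card F : ℝ) : ℝ) * v i' (i.1, g, i.2.2) =
          e (g * (i.2.1 - i'.2.1)) / (Fintype.card F : ℂ) := by
        intro g
        simp only [v, if_pos h1]
        rw [div_mul_div_comm, hsq, ← AddChar.map_add_eq_mul]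
        congr 2
        ring
      simp only [h2]
      rw [← sum_div, AddChar.sum_mulShift _ he]
      have h3 : (Fintype.card F : ℂ) ≠ 0 := by exact_mod_cast hn.ne'
      by_cases h4 : i.2.1 = i'.2.1
      · have : i = i' := Prod.ext h1.1 (Prod.ext h4 h1.2)
        simp [this, h3]
      · have : i ≠ i' := fun h => h4 (by rw [h])
        simp [this, sub_eq_zero, h4]
    · have : i ≠ i' := fun h => h1 (by simp [h])
      simp [v, h1, this]
  obtain ⟨b, hb⟩ := Orthonormal.exists_orthonormalBasis_extension_of_card_eq
    (finrank_euclideanSpace (𝕜 := ℂ) (ι := F × F × Fin w)) (v := v) (s := Set.univ)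
    (hv.comp _ Subtype.val_injective)
  refine ⟨b, fun A ψ i => ?_⟩
  rw [b.repr_apply_apply, b.repr_apply_apply, hb i trivial, inner_v, inner_v, mul_sum,
    ← Equiv.sum_comp (Equiv.addRight (A i.1))]
  refine sum_congr rfl fun g _ => ?_
  simp only [addQuery, Equiv.coe_addRight, add_sub_cancel_right, mul_add, AddChar.map_add_eq_mul]
  ring

end Models

/-! ### Moment vectors of functions with small support -/

section Weight

variable {F : Type*} [Field F] [Fintype F]

open Classical in
/-- The vector `(∑ f x, ∑ f x * x, …, ∑ f x * x ^ d)` of moments of a function. -/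
def moments (d : ℕ) (f : F → F) : Fin (d + 1) → F := ∑ x, f x • powers d x

open Classical in
/-- The support of a function as a finset. -/
def supp (f : F → F) : Finset F := univ.filter fun x => f x ≠ 0

theorem mem_supp {f : F → F} {x : F} : x ∈ supp f ↔ f x ≠ 0 := by simp [supp]

theorem moments_sub (d : ℕ) (f g : F → F) : moments d (f - g) = moments d f - moments d g := by
  simp [moments, sub_smul]

theorem moments_eq_sum_of_supp_subset {d : ℕ} {f : F → F} {S : Finset F} (h : supp f ⊆ S) :
    moments d f = ∑ x ∈ S, f x • powers d x := by
  refine (sum_subset (subset_univ S) fun x _ hx => ?_).symm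
  have : f x = 0 := by
    by_contra h0
    exact hx (h (mem_supp.2 h0))
  simp [this]

/-- The Vandermonde matrix of the distinct points of the support is invertible. -/
theorem eq_zero_of_moments_eq_zero {d : ℕ} {f : F → F} (hf : #(supp f) ≤ d + 1)
    (h : moments d f = 0) : f = 0 := by
  let t := (supp f).equivFin.symm
  have key := Matrix.eq_zero_of_forall_pow_sum_mul_pow_eq_zero (n := #(supp f))
    (f := fun i => (t i : F)) (v := fun i => f (t i))
    (Subtype.val_injective.comp t.injective) (fun i => by
      have := congrFun h ⟨i, by omega⟩
      rw [moments_eq_sum_of_supp_subset subset_rfl] at this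
      rw [Equiv.sum_comp t (fun x : supp f => f x * (x : F) ^ (i : ℕ)),
        sum_coe_sort (supp f) (fun x => f x * x ^ (i : ℕ))]
      simpa [powers] using this)
  funext x
  by_contra hx
  have := congrFun key (t.symm ⟨x, mem_supp.2 hx⟩)
  exact hx (by simpa using this)

theorem moments_mem_powerSums {d q : ℕ} {f : F → F} (hf : #(supp f) ≤ q) :
    moments d f ∈ powerSums F d q := by
  let t := (supp f).equivFin.symm
  refine mem_powerSums.2
    -- Unused slots are padded with node `0` and weight `0`.
    ⟨fun i => if hi : (i : ℕ) < #(supp f) then (t ⟨i, hi⟩, f (t ⟨i, hi⟩)) else 0, ?_⟩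
  obtain ⟨r, rfl⟩ := Nat.exists_eq_add_of_le hf
  rw [Fin.sum_univ_add]
  simp only [Fin.val_castAdd, Fin.is_lt, Fin.val_natAdd, dite_true, Fin.eta]
  rw [moments_eq_sum_of_supp_subset subset_rfl, ← sum_coe_sort (supp f),
    ← Equiv.sum_comp t (fun x : supp f => f x • powers d (x : F))]
  simp

open Classical in
/-- The functions with exactly `k` non-zero values, all of them at points of `T`. -/
def weightFuns (T : Finset F) (k : ℕ) : Finset (F → F) :=
  univ.filter fun f => supp f ⊆ T ∧ #(supp f) = k

theorem mem_weightFuns {T : Finset F} {k : ℕ} {f : F → F} :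
    f ∈ weightFuns T k ↔ supp f ⊆ T ∧ #(supp f) = k := by simp [weightFuns]

theorem card_weightFuns (T : Finset F) (k : ℕ) :
    #(weightFuns T k) = (#T).choose k * (Fintype.card F - 1) ^ k := by
  classical
  rw [card_eq_sum_card_fiberwise (f := supp) (t := powersetCard k T)
    (fun f hf => mem_coe.2 (mem_powersetCard.2 (mem_weightFuns.1 hf))),
    sum_const_nat (m := (Fintype.card F - 1) ^ k), card_powersetCard]
  intro S hS
  obtain ⟨hST, rfl⟩ := mem_powersetCard.1 hS
  have : (weightFuns T #S).filter (fun f => supp f = S) =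
      Fintype.piFinset fun x => if x ∈ S then univ.erase (0 : F) else {0} := by
    ext f
    simp only [mem_filter, mem_weightFuns, Fintype.mem_piFinset]
    constructor
    · rintro ⟨-, rfl⟩ x
      by_cases hx : f x = 0 <;> simp [mem_supp, hx]
    · intro hf
      have : supp f = S := by
        ext x
        have := hf x
        rw [mem_supp]
        by_cases hx : x ∈ S <;> simp_all
      exact ⟨by rw [this]; exact ⟨hST, rfl⟩, this⟩
  rw [this, Fintype.card_piFinset]
  simp only [apply_ite card, card_erase_of_mem (mem_univ _), card_univ, card_singleton]
  rw [prod_ite_mem, univ_inter, prod_const]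

theorem supp_sub_subset [DecidableEq F] (f g : F → F) : supp (f - g) ⊆ supp f ∪ supp g := by
  intro x
  simp only [mem_union, mem_supp, Pi.sub_apply]
  contrapose!
  rintro ⟨h1, h2⟩
  rw [h1, h2, sub_zero]

theorem moments_injOn {d k : ℕ} (hk : 2 * k ≤ d + 1) (T : Finset F) :
    Set.InjOn (moments d) (weightFuns T k : Set (F → F)) := by
  classical
  intro f hf g hg h
  have hf' := (mem_weightFuns.1 hf).2
  have hg' := (mem_weightFuns.1 hg).2
  refine sub_eq_zero.1 (eq_zero_of_moments_eq_zero (d := d) ?_ (by rw [moments_sub, h, sub_self]))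
  have := (card_le_card (supp_sub_subset f g)).trans (card_union_le _ _)
  omega

theorem card_weightFuns_le_card_powerSums {d k : ℕ} (hk : 2 * k ≤ d + 1) :
    (Fintype.card F).choose k * (Fintype.card F - 1) ^ k ≤ #(powerSums F d k) := by
  refine (card_weightFuns (univ : Finset F) k).symm.trans_le ?_
  exact card_le_card_of_injOn (moments d)
    (fun f hf => moments_mem_powerSums (mem_weightFuns.1 hf).2.le) (moments_injOn hk _)

theorem card_powerSums_le_pow (d q : ℕ) : #(powerSums F d q) ≤ Fintype.card F ^ (2 * q) := by
  classical
  refine card_image_le.trans ?_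
  simp [pow_mul, sq]

/-- The nodes of a combination lie in some set of exactly `q` points, which exists because `q ≤ #F`;
weights at repeated nodes are added up. -/
theorem card_powerSums_le_choose {d q : ℕ} (hq : q ≤ Fintype.card F) :
    #(powerSums F d q) ≤ (Fintype.card F).choose q * Fintype.card F ^ q := by
  classical
  have hsub : powerSums F d q ⊆ (powersetCard q univ).biUnion fun S : Finset F =>
      univ.image fun g : S → F => ∑ x, g x • powers d (x : F) := by
    intro y hy
    obtain ⟨p, rfl⟩ := mem_powerSums.1 hy
    have hc : #(univ.image fun i => (p i).1) ≤ q := by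
      simpa using card_image_le (s := univ) (f := fun i => (p i).1)
    obtain ⟨S, hS, -, hSq⟩ := exists_subsuperset_card_eq (subset_univ _) hc (by simpa using hq)
    have hmem : ∀ i, (p i).1 ∈ S := fun i => hS (mem_image_of_mem _ (mem_univ i))
    refine mem_biUnion.2 ⟨S, by simp [hSq], mem_image.2
      ⟨fun x => ∑ i with (p i).1 = x, (p i).2, mem_univ _, ?_⟩⟩
    rw [← sum_fiberwise univ (fun i => (⟨(p i).1, hmem i⟩ : S))]
    refine sum_congr rfl fun x _ => ?_
    rw [sum_smul]
    refine sum_congr (by ext i; simp [Subtype.ext_iff]) fun i hi => ?_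
    rw [show (p i).1 = (x : F) from by simpa [Subtype.ext_iff] using hi]
  refine (card_le_card hsub).trans (card_biUnion_le.trans ?_)
  refine (sum_le_sum (g := fun _ => Fintype.card F ^ q) fun S hS => card_image_le.trans ?_).trans ?_
  · simp [(mem_powersetCard.1 hS).2]
  · simp

open Classical in
/-- The number of pairs of functions of weight `k` with the same `2 * k - 1` moments. -/
theorem card_filter_moments_eq_le {d k : ℕ} (hk : 0 < k) (hd : d + 2 = 2 * k) (T : Finset F) :
    #((weightFuns T k ×ˢ weightFuns T k).filter fun p => moments d p.1 = moments d p.2) ≤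
      #(weightFuns T k) + (#T).choose k ^ 2 * (Fintype.card F - 1) := by
  set P := (weightFuns T k ×ˢ weightFuns T k).filter fun p => moments d p.1 = moments d p.2
  have hP : ∀ {p}, p ∈ P → #(supp p.1) = k ∧ #(supp p.2) = k ∧ supp p.1 ⊆ T ∧ supp p.2 ⊆ T ∧
      moments d (p.1 - p.2) = 0 := by
    intro p hp
    obtain ⟨h1, h2⟩ := mem_filter.1 hp
    obtain ⟨hf, hg⟩ := mem_product.1 h1
    rw [mem_weightFuns] at hf hg
    exact ⟨hf.2, hg.2, hf.1, hg.1, by rw [moments_sub, h2, sub_self]⟩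
  rw [← card_filter_add_card_filter_not (s := P) (fun p => p.1 = p.2)]
  refine Nat.add_le_add ?_ ?_
  · refine card_le_card_of_injOn Prod.fst (fun p hp => ?_) ?_
    · exact (mem_product.1 (mem_filter.1 (mem_filter.1 hp).1).1).1
    · rintro ⟨f, g⟩ h1 ⟨f', g'⟩ h2 h
      have h1' := (mem_filter.1 h1).2
      have h2' := (mem_filter.1 h2).2
      simp_all
  -- If the supports met, the difference would have weight at most `2 * k - 1 = d + 1` and vanish by
  -- Vandermonde.
  · have disj : ∀ {p}, p ∈ P.filter (fun p => ¬ p.1 = p.2) → Disjoint (supp p.1) (supp p.2) := by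
      intro p hp
      obtain ⟨h1, h2⟩ := mem_filter.1 hp
      obtain ⟨hf, hg, -, -, hm⟩ := hP h1
      by_contra hd'
      rw [disjoint_iff_inter_eq_empty, ← card_eq_zero] at hd'
      refine h2 (sub_eq_zero.1 (eq_zero_of_moments_eq_zero (d := d) ?_ hm))
      have h3 := card_le_card (supp_sub_subset p.1 p.2)
      have h4 := card_union_add_card_inter (supp p.1) (supp p.2)
      omega
    -- For fixed disjoint supports, `f - g` lives on `d + 2` points and has `d + 1` vanishing
    -- moments, so one value determines it. The point chosen depends only on `supp f`, and `g`
    -- vanishes there.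
    let pt : Finset F → F := fun S => if h : S.Nonempty then h.choose else 0
    have hpt : ∀ {f : F → F}, #(supp f) = k → pt (supp f) ∈ supp f := by
      intro f hf
      have hne : (supp f).Nonempty := card_pos.1 (by omega)
      simp only [pt, dif_pos hne]
      exact hne.choose_spec
    have := card_le_card_of_injOn (s := P.filter (fun p => ¬ p.1 = p.2))
      (t := (powersetCard k T ×ˢ powersetCard k T) ×ˢ univ.erase (0 : F))
      (fun p => ((supp p.1, supp p.2), p.1 (pt (supp p.1)))) ?_ ?_
    · simpa [sq, card_erase_of_mem] using this
    · intro p hp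
      obtain ⟨hf, hg, hf', hg', -⟩ := hP (mem_filter.1 hp).1
      have := mem_supp.1 (hpt hf)
      simp [mem_powersetCard, *]
    · rintro ⟨f, g⟩ hp ⟨f', g'⟩ hp' h
      simp only [Prod.mk.injEq] at h
      obtain ⟨⟨hS, hS'⟩, hc⟩ := h
      have hdis := disj hp
      have hdis' := disj hp'
      obtain ⟨hf, hg, -, -, hm⟩ := hP (mem_filter.1 hp).1
      obtain ⟨hf', hg', -, -, hm'⟩ := hP (mem_filter.1 hp').1
      simp only at *
      have hx := hpt hf
      rw [← hS] at hc
      set x := pt (supp f)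
      have hgx : g x = 0 := by
        by_contra h0
        exact disjoint_left.1 hdis hx (mem_supp.2 h0)
      have hgx' : g' x = 0 := by
        by_contra h0
        exact disjoint_left.1 hdis hx (hS' ▸ mem_supp.2 h0)
      have hz : (f - g) - (f' - g') = 0 := by
        refine eq_zero_of_moments_eq_zero (d := d) ?_ (by rw [moments_sub, hm, hm', sub_zero])
        have hsub : supp ((f - g) - (f' - g')) ⊆ (supp f ∪ supp g).erase x := by
          intro z hz
          refine mem_erase.2 ⟨?_, ?_⟩
          · rintro rfl
            rw [mem_supp] at hz
            simp [hgx, hgx', hc] at hz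
          · rcases mem_union.1 (supp_sub_subset _ _ hz) with h | h
            · exact supp_sub_subset _ _ h
            · rw [hS, hS']; exact supp_sub_subset _ _ h
        have h1 := card_le_card hsub
        rw [card_erase_of_mem (mem_union_left _ hx), card_union_of_disjoint hdis] at h1
        omega
      have key : ∀ z, f z - g z = f' z - g' z := fun z => sub_eq_zero.1 (congrFun hz z)
      have zero_of : ∀ {u v u' v' : F → F}, Disjoint (supp u) (supp v) → supp u = supp u' →
          supp v = supp v' → (∀ z, u z - v z = u' z - v' z) → u = u' := by
        intro u v u' v' hd hu hv h
        funext z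
        by_cases hz : z ∈ supp u
        · have h1 : v z = 0 := by
            by_contra h0
            exact disjoint_left.1 hd hz (mem_supp.2 h0)
          have h2 : v' z = 0 := by
            by_contra h0
            exact disjoint_left.1 hd hz (hv ▸ mem_supp.2 h0)
          simpa [h1, h2] using h z
        · have h1 : u z = 0 := by simpa [mem_supp] using hz
          have h2 : u' z = 0 := by rw [hu] at hz; simpa [mem_supp] using hz
          rw [h1, h2]
      have hff : f = f' := zero_of hdis hS hS' key
      subst hff
      have : g = g' := by
        funext z
        simpa using key z
      rw [this]

/-- Second moment bound for the number of vectors that are moments of functions of weight `k`. -/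
theorem card_weightFuns_sq_le [DecidableEq F] {d k : ℕ} (hk : 0 < k) (hd : d + 2 = 2 * k)
    (T : Finset F) :
    #(weightFuns T k) ^ 2 ≤ #((weightFuns T k).image (moments d)) *
      (#(weightFuns T k) + (#T).choose k ^ 2 * (Fintype.card F - 1)) := by
  classical
  set W := weightFuns T k
  have h1 : #W = ∑ y ∈ W.image (moments d), #(W.filter fun f => moments d f = y) :=
    card_eq_sum_card_image _ _
  -- Colliding pairs count the squared fibre sizes, to which Cauchy–Schwarz is applied below.
  have h2 : #((W ×ˢ W).filter fun p => moments d p.1 = moments d p.2) =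
      ∑ y ∈ W.image (moments d), #(W.filter fun f => moments d f = y) ^ 2 := by
    rw [card_eq_sum_card_fiberwise (f := fun p => moments d p.1) (t := W.image (moments d))]
    · refine sum_congr rfl fun y _ => ?_
      rw [sq, ← card_product]
      congr 1
      ext p
      simp only [mem_filter, mem_product]
      constructor
      · rintro ⟨⟨⟨a, b⟩, h⟩, rfl⟩
        exact ⟨⟨a, rfl⟩, b, h.symm⟩
      · rintro ⟨⟨a, rfl⟩, b, h⟩
        exact ⟨⟨⟨a, b⟩, h.symm⟩, rfl⟩
    · intro p hp
      exact mem_image_of_mem _ (mem_product.1 (mem_filter.1 hp).1).1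
  calc #W ^ 2 ≤ #(W.image (moments d)) *
        ∑ y ∈ W.image (moments d), #(W.filter fun f => moments d f = y) ^ 2 := by
        nth_rw 1 [h1]
        exact_mod_cast sq_sum_le_card_mul_sum_sq (α := ℕ)
    _ ≤ _ := by
        rw [← h2]
        refine Nat.mul_le_mul_left _ ?_
        convert card_filter_moments_eq_le hk hd T

end Weight

/-! ### Numerical estimates and the three ranges of `q` -/

section Bounds

theorem one_add_choose_two_le_factorial {k : ℕ} (hk : 0 < k) : 1 + k.choose 2 ≤ k.factorial := by
  induction k, hk using Nat.le_induction with
  | base => decide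
  | succ k hk ih =>
    rw [Nat.choose_succ_succ' k 1, Nat.choose_one_right, Nat.factorial_succ]
    have h1 : 1 ≤ k.factorial := Nat.factorial_pos k
    rcases hk.eq_or_lt with rfl | hk2
    · decide
    · nlinarith [Nat.self_le_factorial k]

theorem pow_sub_le_descFactorial (n k : ℕ) :
    (n : ℝ) ^ (k + 1) - (k + 1).choose 2 * (n : ℝ) ^ k ≤ n.descFactorial (k + 1) := by
  induction k with
  | zero => simp
  | succ k ih =>
    rw [Nat.descFactorial_succ]
    rcases le_or_gt (k + 1) n with h | h
    · rw [Nat.cast_mul, Nat.cast_sub h, Nat.choose_succ_succ' (k + 1) 1, Nat.choose_one_right]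
      have h1 : (0 : ℝ) ≤ (n : ℝ) - (k + 1 : ℕ) := sub_nonneg.2 (by exact_mod_cast h)
      have h2 := mul_le_mul_of_nonneg_left ih h1
      have h3 : (0 : ℝ) ≤ (k + 1 : ℕ) * (((k + 1).choose 2 : ℕ) * (n : ℝ) ^ k) := by positivity
      push_cast at *
      rw [pow_succ (n : ℝ) (k + 1), pow_succ (n : ℝ) k] at *
      nlinarith
    · have h1 : (n : ℝ) ≤ ((k + 1 + 1).choose 2 : ℕ) := by
        rw [Nat.choose_succ_succ' (k + 1) 1, Nat.choose_one_right]
        exact_mod_cast h.le.trans (Nat.le_add_right _ _)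
      have h2 := mul_le_mul_of_nonneg_right h1 (pow_nonneg (Nat.cast_nonneg n : (0 : ℝ) ≤ n) (k + 1))
      have h3 : (0 : ℝ) ≤ ((n - (k + 1)) * n.descFactorial (k + 1) : ℕ) := Nat.cast_nonneg _
      rw [pow_succ' (n : ℝ) (k + 1)]
      linarith

/-- The right side is the product of `(1 - i / n) * (1 - 1 / n)` over `i < q`. Each factor loses at
most `(i + 1) / n`, and these losses add up to `(q + 1).choose 2 / n`. -/
theorem one_sub_choose_le_descFactorial_mul (n q : ℕ) (hn : 0 < n) :
    1 - ((q + 1).choose 2 : ℝ) * (1 / n) ≤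
      (n.descFactorial q * (n - 1 : ℝ) ^ q) / (n : ℝ) ^ (2 * q) := by
  have hn' : (0 : ℝ) < n := by exact_mod_cast hn
  have hn1 : (1 : ℝ) ≤ n := by exact_mod_cast hn
  have nonneg : ∀ q, 0 ≤ (n.descFactorial q * (n - 1 : ℝ) ^ q) / (n : ℝ) ^ (2 * q) := fun q => by
    have : (0 : ℝ) ≤ n - 1 := by linarith
    positivity
  induction q with
  | zero => simp
  | succ q ih =>
    rcases lt_or_ge n (q + 1) with h | h
    · refine le_trans ?_ (nonneg _)
      have h1 : (n : ℝ) ≤ ((q + 1 + 1).choose 2 : ℕ) := by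
        rw [Nat.choose_succ_succ' (q + 1) 1, Nat.choose_one_right]
        exact_mod_cast h.le.trans (Nat.le_add_right _ _)
      rw [mul_one_div, sub_nonpos, one_le_div hn']
      exact h1
    · have h1 : ((n.descFactorial (q + 1) : ℕ) * (n - 1 : ℝ) ^ (q + 1)) / (n : ℝ) ^ (2 * (q + 1)) =
          (n.descFactorial q * (n - 1 : ℝ) ^ q) / (n : ℝ) ^ (2 * q) *
            ((1 - q / n) * (1 - 1 / n)) := by
        rw [Nat.descFactorial_succ, Nat.cast_mul, Nat.cast_sub (by omega)]
        field_simp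
        ring
      rw [h1, Nat.choose_succ_succ' (q + 1) 1, Nat.choose_one_right]
      set a := (n.descFactorial q * (n - 1 : ℝ) ^ q) / (n : ℝ) ^ (2 * q)
      have ha0 := nonneg q
      have ha1 : a ≤ 1 := by
        rw [div_le_one (by positivity), two_mul, pow_add]
        have : (0 : ℝ) ≤ n - 1 := by linarith
        gcongr
        · exact_mod_cast Nat.descFactorial_le_pow n q
        · linarith
      have h2 : 1 - ((q : ℝ) + 1) / n ≤ (1 - q / n) * (1 - 1 / n) := by
        have : (0 : ℝ) ≤ q / n * (1 / n) := by positivity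
        rw [add_div]
        nlinarith
      have h3 : a * (1 - ((q : ℝ) + 1) / n) ≤ a * ((1 - q / n) * (1 - 1 / n)) :=
        mul_le_mul_of_nonneg_left h2 ha0
      have h4 : a * (((q : ℝ) + 1) / n) ≤ ((q : ℝ) + 1) / n :=
        mul_le_of_le_one_left (by positivity) ha1
      push_cast
      rw [mul_one_div] at *
      rw [add_div]
      linarith

variable {F : Type*} [Field F] [Fintype F]

open Classical in
/-- The moment vectors of functions of weight `k` that vanish at `0` fill all but a fraction
`(k! + 2 * k - 1) / #F` of a space of dimension `2 * k - 1`. -/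
theorem one_sub_le_card_image_moments {d k : ℕ} (hk : 0 < k) (hd : d + 2 = 2 * k) :
    1 - ((k.factorial : ℝ) + d + 1) / Fintype.card F ≤
      #((weightFuns (univ.erase (0 : F)) k).image (moments d)) /
        (Fintype.card F : ℝ) ^ (d + 1) := by
  set n := Fintype.card F
  have hn2 : 1 < n := Fintype.one_lt_card
  have hn0 : (0 : ℝ) < n := by exact_mod_cast (by omega : 0 < n)
  have hn1 : (0 : ℝ) < n - 1 := sub_pos.2 (by exact_mod_cast hn2)
  set I : ℝ := ((#((weightFuns (univ.erase (0 : F)) k).image (moments d)) : ℕ) : ℝ)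
  -- For `n ≤ k!` the claimed lower bound is not positive.
  rcases le_or_gt (n : ℝ) k.factorial with hkn | hkn
  · refine le_trans ?_ (by positivity : 0 ≤ I / (n : ℝ) ^ (d + 1))
    rw [sub_nonpos, one_le_div hn0]
    linarith [(Nat.cast_nonneg d : (0 : ℝ) ≤ d)]
  set C : ℝ := (((n - 1).choose k : ℕ) : ℝ)
  have hW : (#(weightFuns (univ.erase (0 : F)) k) : ℝ) = C * (n - 1) ^ k := by
    rw [card_weightFuns, card_erase_of_mem (mem_univ _), card_univ, Nat.cast_mul, Nat.cast_pow,
      Nat.cast_sub hn2.le, Nat.cast_one]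
  have hcs : (C * (n - 1) ^ k) ^ 2 ≤ I * (C * (n - 1) ^ k + C ^ 2 * (n - 1)) := by
    have h := card_weightFuns_sq_le hk hd (univ.erase (0 : F))
    rw [card_erase_of_mem (mem_univ _), card_univ] at h
    have h' : ((#(weightFuns (univ.erase (0 : F)) k) ^ 2 : ℕ) : ℝ) ≤ _ := Nat.cast_le.2 h
    rw [Nat.cast_pow, hW, Nat.cast_mul, Nat.cast_add, hW, Nat.cast_mul, Nat.cast_pow,
      Nat.cast_sub hn2.le, Nat.cast_one] at h'
    exact h'
  obtain ⟨l, rfl⟩ : ∃ l, k = l + 1 := ⟨k - 1, by omega⟩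
  obtain rfl : d = 2 * l := by omega
  set t : ℝ := (l + 1).factorial / n
  have ht1 : t < 1 := (div_lt_one hn0).2 hkn
  -- Equivalent to `(1 - t) * ((n - 1) ^ l + C) ≤ C`: the collision term `(n - 1) ^ l` in `hI` costs
  -- at most a factor `1 - t`. The inequality `1 + k.choose 2 ≤ k!` absorbs the error in the falling
  -- factorial.
  have hCt : (1 - t) * (n - 1 : ℝ) ^ l ≤ t * C := by
    have h1 := pow_sub_le_descFactorial (n - 1) l
    rw [Nat.descFactorial_eq_factorial_mul_choose, Nat.cast_mul, Nat.cast_sub hn2.le,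
      Nat.cast_one] at h1
    have h2 : (1 : ℝ) + (l + 1).choose 2 ≤ (l + 1).factorial := by
      exact_mod_cast one_add_choose_two_le_factorial (Nat.succ_pos l)
    have h3 : 0 < (n - 1 : ℝ) ^ l := by positivity
    have h4 : (n - (l + 1).factorial : ℝ) * (n - 1) ^ l ≤ (l + 1).factorial * C := by
      rw [pow_succ] at h1
      nlinarith
    have h5 : 1 - t = (n - (l + 1).factorial : ℝ) / n := by
      simp only [t]; field_simp
    rw [h5, div_mul_eq_mul_div, div_mul_eq_mul_div]
    gcongr
  have hC : 0 < C := by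
    have h3 : 0 < (n - 1 : ℝ) ^ l := by positivity
    have h4 : 0 < t * C := lt_of_lt_of_le (mul_pos (by linarith) h3) hCt
    exact pos_of_mul_pos_right h4 (by positivity)
  have hI : C * (n - 1 : ℝ) ^ (2 * l + 1) ≤ I * ((n - 1) ^ l + C) := by
    refine le_of_mul_le_mul_left ?_ (mul_pos hC hn1)
    calc C * (n - 1 : ℝ) * (C * (n - 1) ^ (2 * l + 1)) = (C * (n - 1) ^ (l + 1)) ^ 2 := by ring
      _ ≤ _ := hcs
      _ = _ := by ring
  have hI2 : (1 - t) * (n - 1 : ℝ) ^ (2 * l + 1) ≤ I := by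
    have h3 : 0 < (n - 1 : ℝ) ^ l := by positivity
    refine le_of_mul_le_mul_right (le_trans ?_ hI) (add_pos h3 hC)
    have h6 : 0 ≤ (n - 1 : ℝ) ^ (2 * l + 1) := by positivity
    have h7 : (1 - t) * ((n - 1 : ℝ) ^ l + C) ≤ C := by linarith
    calc (1 - t) * (n - 1 : ℝ) ^ (2 * l + 1) * ((n - 1) ^ l + C)
        = ((1 - t) * ((n - 1 : ℝ) ^ l + C)) * (n - 1 : ℝ) ^ (2 * l + 1) := by ring
      _ ≤ _ := mul_le_mul_of_nonneg_right h7 h6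
  have hbern : 1 - (2 * l + 1 : ℝ) / n ≤ (n - 1 : ℝ) ^ (2 * l + 1) / (n : ℝ) ^ (2 * l + 1) := by
    have h1 : (-2 : ℝ) ≤ -(1 / n) := by
      have : 1 / (n : ℝ) ≤ 1 := by
        rw [div_le_one hn0]; linarith
      linarith
    have := one_add_mul_le_pow h1 (2 * l + 1)
    rw [← div_pow, sub_div, div_self hn0.ne']
    push_cast at this
    rw [← sub_eq_add_neg, mul_neg, mul_one_div, ← sub_eq_add_neg] at this
    exact this
  have ht0 : 0 ≤ t := by positivity
  calc 1 - (((l + 1).factorial : ℝ) + (2 * l : ℕ) + 1) / n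
      = 1 - t - (2 * l + 1 : ℝ) / n := by
        simp only [t]; push_cast; ring
    _ ≤ (1 - t) * (1 - (2 * l + 1 : ℝ) / n) := by
        have : 0 ≤ t * ((2 * l + 1 : ℝ) / n) := by positivity
        linarith
    _ ≤ (1 - t) * ((n - 1 : ℝ) ^ (2 * l + 1) / (n : ℝ) ^ (2 * l + 1)) :=
        mul_le_mul_of_nonneg_left hbern (by linarith)
    _ ≤ I / (n : ℝ) ^ (2 * l + 1) := by
        rw [← mul_div_assoc]
        gcongr

theorem powerSums_mono (d : ℕ) {q q' : ℕ} (h : q ≤ q') : powerSums F d q ⊆ powerSums F d q' := by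
  induction q', h using Nat.le_induction with
  | base => rfl
  | succ q' _ ih =>
    intro y hy
    simpa using add_mem_powerSums_succ (ih hy) 0 0

theorem moments_succ_tail (d : ℕ) (f : F → F) :
    (fun j => moments (d + 1) f (Fin.succ j)) = moments d fun x => x * f x := by
  ext j
  simp only [moments, powers, Finset.sum_apply, Pi.smul_apply, smul_eq_mul, Fin.val_succ]
  exact sum_congr rfl fun x _ => by ring

open Classical in
/-- The node `0` gives control of the moment of order `0`, and the weights of the other nodes can
be divided by the nodes. -/
theorem card_mul_card_image_moments_le (d k : ℕ) :
    Fintype.card F * #((weightFuns (univ.erase (0 : F)) k).image (moments d)) ≤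
      #(powerSums F (d + 1) (k + 1)) := by
  rw [← card_univ, ← card_product]
  refine card_le_card_of_injOn (fun p => (Fin.cons p.1 p.2 : Fin (d + 2) → F)) ?_ ?_
  · rintro ⟨c, y⟩ hp
    obtain ⟨f, hf, rfl⟩ := mem_image.1 (mem_product.1 hp).2
    obtain ⟨hf0, hfk⟩ := mem_weightFuns.1 hf
    -- Moments of `g` of order `j + 1` are those of `f` of order `j`, as `f` vanishes at `0`. An
    -- extra weight at node `0` changes only the moment of order `0`, which can thus be set to `c`.
    set g : F → F := fun x => x⁻¹ * f x
    have hg : supp g ⊆ supp f := fun x => by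
      simp only [mem_supp, g]
      exact right_ne_zero_of_mul
    have hgf : (fun x => x * g x) = f := by
      ext x
      by_cases hx : x = 0
      · have : x ∉ supp f := fun h => (mem_erase.1 (hf0 h)).1 hx
        rw [mem_supp, not_not] at this
        rw [this, hx, zero_mul]
      · simp [g, hx]
    have hmem := add_mem_powerSums_succ
      (moments_mem_powerSums (d := d + 1) ((card_le_card hg).trans hfk.le))
      (c - moments (d + 1) g 0) 0
    refine mem_coe.2 ((congrArg (· ∈ powerSums F (d + 1) (k + 1)) ?_).mpr hmem)
    refine funext fun j => Fin.cases ?_ (fun j => ?_) j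
    · simp [powers]
    · have := congrFun (moments_succ_tail d g) j
      rw [hgf] at this
      simp [powers, ← this]
  · rintro ⟨c, y⟩ - ⟨c', y'⟩ - h
    simpa [Prod.ext_iff] using (Fin.cons_injective2 h)

theorem one_sub_le_card_powerSums_div {d q : ℕ} (hq : d + 2 ≤ 2 * q) :
    1 - (((d / 2 + 1).factorial : ℝ) + d + 1) / Fintype.card F ≤
      #(powerSums F d q) / (Fintype.card F : ℝ) ^ (d + 1) := by
  classical
  have hn0 : (0 : ℝ) < Fintype.card F := by exact_mod_cast Fintype.card_pos (α := F)
  rcases Nat.even_or_odd' d with ⟨m, rfl | rfl⟩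
  · refine le_trans (le_trans (le_of_eq ?_)
      (one_sub_le_card_image_moments (F := F) (d := 2 * m) (k := m + 1) (by omega) (by ring))) ?_
    · rw [show 2 * m / 2 + 1 = m + 1 by omega]
    · gcongr
      intro y hy
      obtain ⟨f, hf, rfl⟩ := mem_image.1 hy
      exact moments_mem_powerSums ((mem_weightFuns.1 hf).2.le.trans (by omega))
  · have h1 := one_sub_le_card_image_moments (F := F) (d := 2 * m) (k := m + 1) (by omega) (by ring)
    have h2 : (Fintype.card F : ℝ) * #((weightFuns (univ.erase (0 : F)) (m + 1)).image
        (moments (2 * m))) ≤ #(powerSums F (2 * m + 1) q) := by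
      exact_mod_cast (card_mul_card_image_moments_le (2 * m) (m + 1)).trans
        (card_le_card (powerSums_mono _ (by omega)))
    refine le_trans (le_trans ?_ h1) ?_
    · rw [show (2 * m + 1) / 2 + 1 = m + 1 by omega]
      gcongr
      omega
    · rw [div_le_div_iff₀ (by positivity) (by positivity), pow_succ _ (2 * m + 1)]
      nlinarith [mul_le_mul_of_nonneg_right h2 (by positivity : 0 ≤ (Fintype.card F : ℝ) ^ (2 * m + 1))]

/-- A combination of `q` vectors has only `2 * q ≤ d` parameters in `F`. -/
theorem card_powerSums_div_le_one_div_card {d q : ℕ} (hq : 2 * q ≤ d) :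
    #(powerSums F d q) / (Fintype.card F : ℝ) ^ (d + 1) ≤ 1 / Fintype.card F := by
  have hn0 : 0 < Fintype.card F := Fintype.card_pos
  have h : (#(powerSums F d q) : ℝ) ≤ (Fintype.card F : ℝ) ^ d := by
    exact_mod_cast (card_powerSums_le_pow d q).trans (Nat.pow_le_pow_right hn0 hq)
  have hn0' : (0 : ℝ) < Fintype.card F := by exact_mod_cast hn0
  rw [pow_succ, ← div_div]
  gcongr
  exact (div_le_one (by positivity)).2 h

theorem le_card_powerSums_div {d q : ℕ} (hq : 2 * q = d + 1) :
    1 / (q.factorial : ℝ) * (1 - ((q + 1).choose 2 : ℝ) * (1 / (Fintype.card F : ℝ))) ≤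
      #(powerSums F d q) / (Fintype.card F : ℝ) ^ (d + 1) := by
  have hn0 : 0 < Fintype.card F := Fintype.card_pos
  have hn0' : (0 : ℝ) < Fintype.card F := by exact_mod_cast hn0
  have h1 : (((Fintype.card F).choose q : ℕ) : ℝ) * ((Fintype.card F : ℝ) - 1) ^ q ≤
      #(powerSums F d q) := by
    have : (((Fintype.card F).choose q * (Fintype.card F - 1) ^ q : ℕ) : ℝ) ≤ _ :=
      Nat.cast_le.2 (card_weightFuns_le_card_powerSums (F := F) hq.le)
    rwa [Nat.cast_mul, Nat.cast_pow, Nat.cast_sub hn0, Nat.cast_one] at this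
  have h2 := one_sub_choose_le_descFactorial_mul (Fintype.card F) q hn0
  have hf : (0 : ℝ) < q.factorial := by exact_mod_cast q.factorial_pos
  calc _ ≤ 1 / (q.factorial : ℝ) * _ := mul_le_mul_of_nonneg_left h2 (by positivity)
    _ = ((Fintype.card F).choose q : ℕ) * ((Fintype.card F : ℝ) - 1) ^ q /
        (Fintype.card F : ℝ) ^ (d + 1) := by
      rw [Nat.descFactorial_eq_factorial_mul_choose, hq, Nat.cast_mul]
      field_simp
    _ ≤ _ := by gcongr

theorem card_powerSums_div_le_one_div_factorial {d q : ℕ} (hq : 2 * q = d + 1)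
    (hn : q ≤ Fintype.card F) :
    #(powerSums F d q) / (Fintype.card F : ℝ) ^ (d + 1) ≤ 1 / (q.factorial : ℝ) := by
  have hn0' : (0 : ℝ) < Fintype.card F := by exact_mod_cast Fintype.card_pos (α := F)
  have hf : (0 : ℝ) < q.factorial := by exact_mod_cast q.factorial_pos
  have h1 : (#(powerSums F d q) : ℝ) ≤ (Fintype.card F).choose q * (Fintype.card F : ℝ) ^ q := by
    exact_mod_cast card_powerSums_le_choose hn
  rw [div_le_iff₀ (by positivity)]
  calc (#(powerSums F d q) : ℝ) ≤ _ := h1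
    _ ≤ ((Fintype.card F : ℝ) ^ q / q.factorial) * (Fintype.card F : ℝ) ^ q := by
      gcongr
      exact Nat.choose_le_pow_div q _
    _ = _ := by rw [← hq, two_mul, pow_add]; ring

end Bounds

end QuantumQuery

end

theorem theorem5p3 {F : Type*} [Field F] [Fintype F] (d q : ℕ) :
    ∃ P : ℝ,
      IsGreatest (QuantumQuery.interpolationProbs (F := F) QuantumQuery.phaseQuery d q) P ∧
      IsGreatest (QuantumQuery.interpolationProbs (F := F) QuantumQuery.addQuery d q) P ∧
      ((q : ℝ) ≤ (d : ℝ) / 2 → P ≤ 1 / (Fintype.card F : ℝ)) ∧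
      ((q : ℝ) = (d : ℝ) / 2 + 1 / 2 →
        1 / (q.factorial : ℝ) * (1 - ((q + 1).choose 2 : ℝ) * (1 / (Fintype.card F : ℝ))) ≤ P ∧
        (q ≤ Fintype.card F → P ≤ 1 / (q.factorial : ℝ))) ∧
      ((d : ℝ) / 2 + 1 ≤ (q : ℝ) →
        1 - (((d / 2 + 1).factorial : ℝ) + (d : ℝ) + 1) / (Fintype.card F : ℝ) ≤ P) := by
  have he := AddChar.FiniteField.primitiveChar_to_Complex_isPrimitive F
  refine ⟨_, (QuantumQuery.isDiagonal_phaseQuery he).isGreatest he d q,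
    (QuantumQuery.isDiagonal_addQuery he).isGreatest he d q, fun h => ?_, fun h => ?_, fun h => ?_⟩
  · have hq : 2 * q ≤ d := by
      have : 2 * (q : ℝ) ≤ d := by linarith
      exact_mod_cast this
    exact QuantumQuery.card_powerSums_div_le_one_div_card hq
  · have hq : 2 * q = d + 1 := by
      have : 2 * (q : ℝ) = d + 1 := by linarith
      exact_mod_cast this
    exact ⟨QuantumQuery.le_card_powerSums_div hq,
      QuantumQuery.card_powerSums_div_le_one_div_factorial hq⟩
  · have hq : d + 2 ≤ 2 * q := by
      have : (d : ℝ) + 2 ≤ 2 * q := by linarith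
      exact_mod_cast this
    exact QuantumQuery.one_sub_le_card_powerSums_div hq
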